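/- Let $\mathcal C$ be the unit circle in $\mathbb R^2=\mathbb C$, with geodesic distance $d(x,y)=|\underline x-\underline y|\wedge(2\pi-|\underline x-\underline y|)$, where $\underline x\in[0,2\pi)$ is the argument of $x$, and let $\mathcal O$ be the orthogonal group of $\mathbb R^2$. For $\mathbf x,\mathbf y\in\mathcal C^n$ put $d_\infty(\mathbf x,\mathbf y)=\max_{i}d(x_i,y_i)$, and for $Q\in\mathcal O$ put $Q\mathbf x=(Qx_1,\dots,Qx_n)$. Let $\Pi_n=\{(e^{2\pi\iota\sigma(j)/n})_{1\le j\le n}:\sigma \text{ a permutation of }\{1,\dots,n\}\}$ and $d_\infty(\mathbf x,\Pi_n)=\min_{\mathbf y\in\Pi_n}d_\infty(\mathbf x,\mathbf y)$. For $c_e\ge 0$ and $0<c_l\le c_L$, let $\mathcal{BL}[c_l,c_L,c_e]$ be the set of symmetric functions $f:\mathcal C^2\to[0,1]$ such that, with $\varepsilon_n=c_e\sqrt{\log(n)/n}$, for all $x,y,y'\in\mathcal C$, $$|f(x,y)-f(x,y')|\le c_L\,d(y,y')+\varepsilon_n,$$ $$f(x,y')-f(x,y)\ge c_l\big(d(x,y)-d(x,y')\big)-\varepsilon_n\quad\text{if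 } d(x,y)\ge d(x,y').$$ For an $n\times n$ matrix $F$, let $\mathcal R[F,c_l,c_L,c_e]$ be the set of pairs $(\mathbf x,f)\in\mathcal C^n\times\mathcal{BL}[c_l,c_L,c_e]$ with $f(x_i,x_j)=F_{ij}$ for all $i<j$. **Proposition.** Let $c_e\ge 0$ and $0<c_l\le c_L$. There exists a constant $C>0$, depending only on $c_e,c_l,c_L$, such that the following holds for every $n\ge 1$ and every symmetric real $n\times n$ matrix $F$ given by $F_{ij}=f^*(x^*_i,x^*_j)$ for $1\le i<j\le n$, for some $\mathbf x^*\in\mathcal C^n$ and $f^*\in\mathcal{BL}[c_l,c_L,c_e]$. For any $(\mathbf x,f),(\mathbf x',f')\in\mathcal R[F,c_l,c_L,c_e]$, $$\min_{Q\in\mathcal O}d_\infty(\mathbf x,Q\mathbf x')\le C\left(d_\infty(\mathbf x,\Pi_n)+d_\infty(\mathbf x',\Pi_n)+\sqrt{\frac{\log n}{n}}\right).$$ If, in addition, $c_e=0$ and $\mathbf x,\mathbf x'\in\Pi_n$, then there exists $Q\in\mathcal O$ such that $\mathbf x=Q\mathbf x'$. -/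

import Mathlib

noncomputable section

namespace CircleSeriation

/-- The argument in `[0, 2π)` of a point of the unit circle. -/
def argument (x : Circle) : ℝ := toIcoMod Real.two_pi_pos 0 (Complex.arg (x : ℂ))

/-- The geodesic distance on the unit circle, in terms of the arguments. -/
def geoDist (x y : Circle) : ℝ :=
  min |argument x - argument y| (2 * Real.pi - |argument x - argument y|)

/-- The maximum distance `max_i d(x_i, y_i)` between two `n`-tuples (`n ≥ 1`). -/
def maxDist {n : ℕ} (x y : Fin n → Circle) : ℝ := ⨆ i, geoDist (x i) (y i)

/-- The set `Π_n` of regular positions `(e^{2πi σ(j)/n})_{1 ≤ j ≤ n}`, `σ` a permutation.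
The index `j : Fin n` stands for `j + 1 ∈ {1, …, n}`. -/
def regularPositions (n : ℕ) : Set (Fin n → Circle) :=
  {x | ∃ σ : Equiv.Perm (Fin n), ∀ j,
    x j = Circle.exp (2 * Real.pi * (((σ j : ℕ) : ℝ) + 1) / (n : ℝ))}

/-- `d_∞(x, Π_n)`, the distance of a tuple to the (finite, nonempty) set of regular positions;
the infimum is a minimum by `exists_maxDist_eq_distToRegular`. -/
def distToRegular {n : ℕ} (x : Fin n → Circle) : ℝ :=
  ⨅ y : regularPositions n, maxDist x y

/-- Action on the unit circle of an element of the orthogonal group of `ℝ² = ℂ`, that is, of a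
linear isometry of `ℂ` over `ℝ`. -/
def orthAct (Q : ℂ ≃ₗᵢ[ℝ] ℂ) (x : Circle) : Circle :=
  ⟨Q x, mem_sphere_zero_iff_norm.2 (by rw [Q.norm_map, Circle.norm_coe])⟩

theorem coe_orthAct (Q : ℂ ≃ₗᵢ[ℝ] ℂ) (x : Circle) : (orthAct Q x : ℂ) = Q (x : ℂ) := rfl

/-- `Q x = (Q x_1, …, Q x_n)`. -/
def orthTuple {n : ℕ} (Q : ℂ ≃ₗᵢ[ℝ] ℂ) (x : Fin n → Circle) : Fin n → Circle :=
  fun i => orthAct Q (x i)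

/-- `min_Q d_∞(x, Q x')` over the orthogonal group of the plane;
the infimum is a minimum by `exists_maxDist_eq_orbitDist`. -/
def orbitDist {n : ℕ} (x x' : Fin n → Circle) : ℝ :=
  ⨅ Q : ℂ ≃ₗᵢ[ℝ] ℂ, maxDist x (orthTuple Q x')

/-- The slack `ε_n = c_e √(log n / n)`. -/
def slack (ce : ℝ) (n : ℕ) : ℝ := ce * Real.sqrt (Real.log (n : ℝ) / (n : ℝ))

/-- The class `BL[c_l, c_L, c_e]` of bi-Lipschitz functions (for sample size `n`). -/
structure IsBiLipschitz (n : ℕ) (cl cL ce : ℝ) (f : Circle → Circle → ℝ) : Prop where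
  mem_Icc : ∀ x y, f x y ∈ Set.Icc (0 : ℝ) 1
  symm : ∀ x y, f x y = f y x
  upper : ∀ x y y', |f x y - f x y'| ≤ cL * geoDist y y' + slack ce n
  lower : ∀ x y y', geoDist x y' ≤ geoDist x y →
    cl * (geoDist x y - geoDist x y') - slack ce n ≤ f x y' - f x y

/-- The set `R[F, c_l, c_L, c_e]` of representations `(x, f)` of the matrix `F`. -/
def representations {n : ℕ} (F : Matrix (Fin n) (Fin n) ℝ) (cl cL ce : ℝ) :
    Set ((Fin n → Circle) × (Circle → Circle → ℝ)) :=
  {p | IsBiLipschitz n cl cL ce p.2 ∧ ∀ i j, i < j → p.2 (p.1 i) (p.1 j) = F i j}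

/-! The geodesic distance is the unoriented angle, and the two infima above are minima. -/

theorem geoDist_eq_angle (x y : Circle) :
    geoDist x y = InnerProductGeometry.angle (x : ℂ) (y : ℂ) := by
  have hexp : ∀ z : Circle, (z : ℂ) = Complex.exp ((argument z : ℂ) * Complex.I) := by
    intro z
    have h : argument z = Complex.arg (z : ℂ)
        - (toIcoDiv Real.two_pi_pos 0 (Complex.arg (z : ℂ)) : ℝ) * (2 * Real.pi) := by
      rw [argument, toIcoMod, zsmul_eq_mul]
    have h2 : Circle.exp (argument z) = z := by
      rw [h, Circle.exp_sub, Circle.exp_int_mul_two_pi, Circle.exp_arg, div_one]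
    rw [← Circle.coe_exp, h2]
  have hmem : ∀ z : Circle, 0 ≤ argument z ∧ argument z < 2 * Real.pi := by
    intro z
    have := toIcoMod_mem_Ico Real.two_pi_pos 0 (Complex.arg (z : ℂ))
    simpa [argument] using this
  obtain ⟨hx0, hx1⟩ := hmem x
  obtain ⟨hy0, hy1⟩ := hmem y
  have hpi := Real.pi_pos
  rw [hexp x, hexp y, InnerProductGeometry.angle, geoDist]
  set t := argument x - argument y with ht
  have hcos : inner ℝ (Complex.exp ((argument x : ℂ) * Complex.I))
      (Complex.exp ((argument y : ℂ) * Complex.I)) /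
      (‖Complex.exp ((argument x : ℂ) * Complex.I)‖ *
        ‖Complex.exp ((argument y : ℂ) * Complex.I)‖) = Real.cos |t| := by
    rw [Complex.norm_exp_ofReal_mul_I, Complex.norm_exp_ofReal_mul_I, Complex.inner, Real.cos_abs,
      ht, Real.cos_sub]
    simp [Complex.exp_ofReal_mul_I_re, Complex.exp_ofReal_mul_I_im]
    ring
  rw [hcos]
  have habs : |t| < 2 * Real.pi := by
    rw [abs_lt]; constructor <;> linarith
  have h0 := abs_nonneg t
  rcases le_total |t| Real.pi with h | h
  · rw [Real.arccos_cos h0 h, min_eq_left]; linarith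
  · rw [← Real.cos_two_pi_sub, Real.arccos_cos (by linarith) (by linarith), min_eq_right]
    linarith

theorem regularPositions_nonempty (n : ℕ) : (regularPositions n).Nonempty :=
  ⟨_, 1, fun _ => rfl⟩

theorem regularPositions_finite (n : ℕ) : (regularPositions n).Finite := by
  refine (Set.finite_range (fun σ : Equiv.Perm (Fin n) => fun j : Fin n =>
    Circle.exp (2 * Real.pi * (((σ j : ℕ) : ℝ) + 1) / (n : ℝ)))).subset ?_
  rintro x ⟨σ, hσ⟩
  exact ⟨σ, (funext hσ).symm⟩

theorem exists_maxDist_eq_distToRegular {n : ℕ} (x : Fin n → Circle) :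
    ∃ y ∈ regularPositions n, maxDist x y = distToRegular x := by
  have := (regularPositions_finite n).to_subtype
  have := (regularPositions_nonempty n).to_subtype
  obtain ⟨y, hy⟩ := exists_eq_ciInf_of_finite (f := fun y : regularPositions n => maxDist x y)
  exact ⟨y, y.2, hy⟩

theorem exists_maxDist_eq_orbitDist {n : ℕ} (hn : 0 < n) (x x' : Fin n → Circle) :
    ∃ Q : ℂ ≃ₗᵢ[ℝ] ℂ, maxDist x (orthTuple Q x') = orbitDist x x' := by
  have : Nonempty (Fin n) := ⟨⟨0, hn⟩⟩
  have hcont : ∀ w : Fin n → Circle,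
      Continuous fun a : Circle => ⨆ i, geoDist (x i) (a * w i) := by
    intro w
    have h1 : (fun a : Circle => ⨆ i, geoDist (x i) (a * w i)) =
        fun a => Finset.univ.sup' Finset.univ_nonempty fun i => geoDist (x i) (a * w i) := by
      funext a
      rw [Finset.sup'_univ_eq_ciSup]
    rw [h1]
    refine Continuous.finset_sup'_apply _ fun i _ => ?_
    refine continuous_iff_continuousAt.2 fun a => ?_
    simp only [geoDist_eq_angle]
    have h2 := InnerProductGeometry.continuousAt_angle
      (x := ((x i : ℂ), ((a * w i : Circle) : ℂ))) (Circle.coe_ne_zero _) (Circle.coe_ne_zero _)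
    exact ContinuousAt.comp (f := fun a : Circle => ((x i : ℂ), ((a * w i : Circle) : ℂ))) h2
      (by fun_prop)
  have hrot : ∀ a, maxDist x (orthTuple (rotation a) x') = ⨆ i, geoDist (x i) (a * x' i) := by
    intro a
    refine iSup_congr fun i => ?_
    congr 1
  have href : ∀ a, maxDist x (orthTuple (Complex.conjLIE.trans (rotation a)) x') =
      ⨆ i, geoDist (x i) (a * (x' i)⁻¹) := by
    intro a
    refine iSup_congr fun i => ?_
    congr 1
    ext
    simp [orthTuple, orthAct, ← Circle.coe_inv_eq_conj]
  obtain ⟨a, -, ha⟩ := isCompact_univ.exists_isMinOn Set.univ_nonempty (hcont x').continuousOn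
  obtain ⟨b, -, hb⟩ :=
    isCompact_univ.exists_isMinOn Set.univ_nonempty (hcont fun i => (x' i)⁻¹).continuousOn
  have key : ∃ Q : ℂ ≃ₗᵢ[ℝ] ℂ, ∀ Q', maxDist x (orthTuple Q x') ≤ maxDist x (orthTuple Q' x') := by
    rcases le_total (maxDist x (orthTuple (rotation a) x'))
      (maxDist x (orthTuple (Complex.conjLIE.trans (rotation b)) x')) with h | h
    · refine ⟨rotation a, fun Q' => ?_⟩
      obtain ⟨c, rfl | rfl⟩ := linear_isometry_complex Q'
      · rw [hrot c, hrot a]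
        exact ha (Set.mem_univ c)
      · refine h.trans ?_
        rw [href c, href b]
        exact hb (Set.mem_univ c)
    · refine ⟨Complex.conjLIE.trans (rotation b), fun Q' => ?_⟩
      obtain ⟨c, rfl | rfl⟩ := linear_isometry_complex Q'
      · refine h.trans ?_
        rw [hrot c, hrot a]
        exact ha (Set.mem_univ c)
      · rw [href c, href b]
        exact hb (Set.mem_univ c)
  obtain ⟨Q, hQ⟩ := key
  exact ⟨Q, le_antisymm (le_ciInf hQ)
    (ciInf_le ⟨maxDist x (orthTuple Q x'), by rintro _ ⟨Q', rfl⟩; exact hQ Q'⟩ Q)⟩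

end CircleSeriation

end

noncomputable section

namespace CircleSeriation

open Real

/-! ### The geodesic distance -/

/-! For fixed `i`, the entry `F i j` decreases, up to the slack, as `j` moves away from `i`. So two
representations rank the indices by distance to `i` alike, up to `2ε/c_l`
(`geoDist_le_of_representations`). Near regular positions, rank determines distance: the number of
indices within `r` of `i` is that of the `n`-th roots of unity within `r` of `1`, up to a shift of
`r`. Hence all pairwise distances of the two tuples agree up to `2ε/c_l + 2D + 2D' + 2π/n`
(`geoDist_le_add_of_representations`).

It remains to pass from distances to positions. Cosines of distances are inner products, so a point
is recovered from its distances to two nearly orthogonal points of the tuple, once a reflection is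
fixed (`exists_orthAct_near`). For regular tuples without slack the ranks give equality of
distances, and equal Gram matrices force congruence (`exists_orthAct_eq`). -/

theorem geoDist_nonneg (x y : Circle) : 0 ≤ geoDist x y := by
  rw [geoDist_eq_angle]; exact InnerProductGeometry.angle_nonneg _ _

theorem geoDist_le_pi (x y : Circle) : geoDist x y ≤ π := by
  rw [geoDist_eq_angle]; exact InnerProductGeometry.angle_le_pi _ _

theorem geoDist_self (x : Circle) : geoDist x x = 0 := by
  rw [geoDist_eq_angle, InnerProductGeometry.angle_self (Circle.coe_ne_zero _)]

theorem geoDist_comm (x y : Circle) : geoDist x y = geoDist y x := by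
  rw [geoDist_eq_angle, geoDist_eq_angle, InnerProductGeometry.angle_comm]

theorem geoDist_triangle (x y z : Circle) : geoDist x z ≤ geoDist x y + geoDist y z := by
  simp only [geoDist_eq_angle]; exact InnerProductGeometry.angle_le_angle_add_angle _ _ _

theorem geoDist_orthAct (Q : ℂ ≃ₗᵢ[ℝ] ℂ) (x y : Circle) :
    geoDist (orthAct Q x) (orthAct Q y) = geoDist x y := by
  simp only [geoDist_eq_angle, coe_orthAct]
  exact Q.toLinearIsometry.angle_map _ _

theorem orthAct_rotation (a x : Circle) : orthAct (rotation a) x = a * x := by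
  ext; rfl

theorem geoDist_mul_left (a x y : Circle) : geoDist (a * x) (a * y) = geoDist x y := by
  rw [← orthAct_rotation, ← orthAct_rotation, geoDist_orthAct]

theorem cos_geoDist (x y : Circle) :
    cos (geoDist x y) = (x : ℂ).re * (y : ℂ).re + (x : ℂ).im * (y : ℂ).im := by
  rw [geoDist_eq_angle, InnerProductGeometry.cos_angle, Circle.norm_coe, Circle.norm_coe,
    Complex.inner]
  simp
  ring

theorem re_sq_add_im_sq (x : Circle) : (x : ℂ).re ^ 2 + (x : ℂ).im ^ 2 = 1 := by
  have h := Circle.normSq_coe x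
  rw [Complex.normSq_apply] at h
  linarith

theorem norm_sub_sq (x y : Circle) : ‖(x : ℂ) - y‖ ^ 2 = 2 - 2 * cos (geoDist x y) := by
  rw [cos_geoDist, ← Complex.normSq_eq_norm_sq, Complex.normSq_apply, Complex.sub_re,
    Complex.sub_im]
  linarith [re_sq_add_im_sq x, re_sq_add_im_sq y]

theorem norm_sub_le_geoDist (x y : Circle) : ‖(x : ℂ) - y‖ ≤ geoDist x y := by
  refine le_of_sq_le_sq ?_ (geoDist_nonneg x y)
  rw [norm_sub_sq]
  linarith [one_sub_sq_div_two_le_cos (x := geoDist x y)]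

theorem geoDist_le_norm_sub (x y : Circle) : geoDist x y ≤ π / 2 * ‖(x : ℂ) - y‖ := by
  have hpi := pi_pos
  refine le_of_sq_le_sq ?_ (by positivity)
  rw [mul_pow, norm_sub_sq]
  have h := cos_le_one_sub_mul_cos_sq (x := geoDist x y)
    (by rw [abs_of_nonneg (geoDist_nonneg x y)]; exact geoDist_le_pi x y)
  have h2 : (π / 2) ^ 2 * (2 * (2 / π ^ 2 * geoDist x y ^ 2)) = geoDist x y ^ 2 := by
    field_simp
  rw [← h2]
  gcongr
  linarith

theorem geoDist_exp (a b : ℝ) : geoDist (Circle.exp a) (Circle.exp b) = arccos (cos (a - b)) := by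
  rw [← arccos_cos (geoDist_nonneg _ _) (geoDist_le_pi _ _), cos_geoDist]
  simp [Circle.coe_exp, Complex.exp_ofReal_mul_I_re, Complex.exp_ofReal_mul_I_im, cos_sub]

theorem geoDist_exp_of_abs_le {a b : ℝ} (h : |a - b| ≤ π) :
    geoDist (Circle.exp a) (Circle.exp b) = |a - b| := by
  rw [geoDist_exp, ← cos_abs, arccos_cos (abs_nonneg _) h]

theorem geoDist_exp_le (a b : ℝ) : geoDist (Circle.exp a) (Circle.exp b) ≤ |a - b| := by
  rcases le_total |a - b| π with h | h
  · exact (geoDist_exp_of_abs_le h).le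
  · exact (geoDist_le_pi _ _).trans h

theorem geoDist_le_maxDist {n : ℕ} (x y : Fin n → Circle) (i : Fin n) :
    geoDist (x i) (y i) ≤ maxDist x y :=
  le_ciSup (f := fun i => geoDist (x i) (y i)) (Set.finite_range _).bddAbove i

theorem maxDist_nonneg {n : ℕ} (x y : Fin n → Circle) : 0 ≤ maxDist x y :=
  Real.iSup_nonneg fun _ => geoDist_nonneg _ _

theorem maxDist_self {n : ℕ} (x : Fin n → Circle) : maxDist x x = 0 := by
  simp [maxDist, geoDist_self]

theorem distToRegular_nonneg {n : ℕ} (x : Fin n → Circle) : 0 ≤ distToRegular x :=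
  Real.iInf_nonneg fun _ => maxDist_nonneg _ _

theorem orbitDist_le {n : ℕ} (x x' : Fin n → Circle) (Q : ℂ ≃ₗᵢ[ℝ] ℂ) :
    orbitDist x x' ≤ maxDist x (orthTuple Q x') :=
  ciInf_le ⟨0, by rintro _ ⟨Q', rfl⟩; exact maxDist_nonneg _ _⟩ Q

/-! ### Regular positions and counting -/

/-- A tuple of regular positions enumerates the values of `ZMod.toCircle`. -/
theorem exists_equiv_zmod {n : ℕ} [NeZero n] {y : Fin n → Circle}
    (hy : y ∈ regularPositions n) :
    ∃ e : Fin n ≃ ZMod n, ∀ k, y k = ZMod.toCircle (e k) := by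
  obtain ⟨σ, hσ⟩ := hy
  refine ⟨(σ.trans (ZMod.finEquiv n).toEquiv).trans (Equiv.addRight 1), fun k => ?_⟩
  have h : ((σ.trans (ZMod.finEquiv n).toEquiv).trans (Equiv.addRight 1)) k =
      (((σ k : ℕ) + 1 : ℕ) : ZMod n) := by
    have h1 : ZMod.finEquiv n (σ k) = ((σ k : ℕ) : ZMod n) := by
      cases n with
      | zero => exact (σ k).elim0
      | succ n => exact (Fin.cast_val_eq_self (σ k)).symm
    simp [h1]
  rw [h, hσ k]
  ext
  rw [ZMod.toCircle_natCast, Circle.coe_exp]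
  push_cast
  congr 1
  ring

theorem toCircle_natCast_eq_exp (n : ℕ) [NeZero n] (m : ℕ) :
    ZMod.toCircle (m : ZMod n) = Circle.exp (2 * π * m / n) := by
  ext
  rw [ZMod.toCircle_natCast, Circle.coe_exp]
  push_cast
  congr 1
  ring

theorem geoDist_toCircle (n : ℕ) [NeZero n] (a b : ZMod n) :
    geoDist (ZMod.toCircle a) (ZMod.toCircle b) = geoDist 1 (ZMod.toCircle (b - a)) := by
  conv_lhs => rw [← sub_add_cancel b a, add_comm, AddChar.map_add_eq_mul,
    ← mul_one (ZMod.toCircle a), mul_assoc, one_mul, geoDist_mul_left]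

/-- The number of `n`-th roots of unity at distance at most `r` of `1`. -/
def rootCount (n : ℕ) [NeZero n] (r : ℝ) : ℕ :=
  {m : ZMod n | geoDist 1 (ZMod.toCircle m) ≤ r}.ncard

/-- Rotation by the inverse of the root at `i` permutes the roots, so the count does not depend on
the centre. -/
theorem ncard_index_eq_rootCount {n : ℕ} [NeZero n] (e : Fin n ≃ ZMod n) (i : Fin n) (r : ℝ) :
    {k : Fin n | geoDist (ZMod.toCircle (e i)) (ZMod.toCircle (e k)) ≤ r}.ncard =
      rootCount n r := by
  rw [rootCount, ← Set.ncard_image_of_injective _ (e.trans (Equiv.subRight (e i))).injective]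
  congr 1
  ext m
  simp only [Set.mem_image, Set.mem_ofPred_eq, geoDist_toCircle]
  constructor
  · rintro ⟨k, hk, rfl⟩
    exact hk
  · intro hm
    exact ⟨e.symm (m + e i), by simpa using hm, by simp⟩

theorem rootCount_lt {n : ℕ} [NeZero n] {r s : ℝ} (hrs : r < s) (m : ZMod n)
    (hr : r < geoDist 1 (ZMod.toCircle m)) (hs : geoDist 1 (ZMod.toCircle m) ≤ s) :
    rootCount n r < rootCount n s := by
  refine Set.ncard_lt_ncard ⟨fun k hk => le_trans hk hrs.le, fun h => ?_⟩ (Set.toFinite _)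
  exact absurd (h (show m ∈ _ from hs)) (not_le.2 hr)

/-- Otherwise the root whose angle is the largest multiple of `2π/n` below `s` lies in `(r, s]`, and
the counts differ. The bound `s ≤ π` makes its angle equal its distance to `1`. -/
theorem le_of_rootCount_le {n : ℕ} [NeZero n] {r s : ℝ} (hr : 0 ≤ r) (hs : s ≤ π)
    (h : rootCount n s ≤ rootCount n r) : s ≤ r + 2 * π / n := by
  by_contra! hlt
  have hn : (0 : ℝ) < n := Nat.cast_pos.2 (NeZero.pos n)
  have hpi := pi_pos
  have hs0 : 0 ≤ s := by have : 0 < 2 * π / n := by positivity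
                         linarith
  set m := ⌊s * n / (2 * π)⌋₊ with hm
  have h1 : (m : ℝ) ≤ s * n / (2 * π) := Nat.floor_le (by positivity)
  have h2 : s * n / (2 * π) < m + 1 := Nat.lt_floor_add_one _
  have h1' : 2 * π * m / n ≤ s := by
    rw [le_div_iff₀ (by positivity)] at h1
    rw [div_le_iff₀ hn]; linarith
  have h2' : s - 2 * π / n < 2 * π * m / n := by
    rw [div_lt_iff₀ (by positivity)] at h2
    rw [sub_lt_iff_lt_add, ← add_div, lt_div_iff₀ hn]; linarith
  have hd : geoDist 1 (ZMod.toCircle (m : ZMod n)) = 2 * π * m / n := by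
    have h0 : (0 : ℝ) ≤ 2 * π * m / n := by positivity
    have habs : |0 - 2 * π * m / n| = 2 * π * m / n := by
      rw [zero_sub, abs_neg, abs_of_nonneg h0]
    rw [toCircle_natCast_eq_exp, ← Circle.exp_zero, geoDist_exp_of_abs_le, habs]
    rw [habs]; linarith
  have hrs : r < s := by have : 0 < 2 * π / n := by positivity
                         linarith
  exact absurd h (not_le.2 (rootCount_lt hrs (m : ZMod n) (by rw [hd]; linarith)
    (by rw [hd]; exact h1')))

/-- Every point of the circle is within `2π/n` of one of the regular positions. -/
theorem exists_geoDist_le {n : ℕ} [NeZero n] (e : Fin n ≃ ZMod n) (z : Circle) :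
    ∃ k, geoDist z (ZMod.toCircle (e k)) ≤ 2 * π / n := by
  have hn : (0 : ℝ) < n := Nat.cast_pos.2 (NeZero.pos n)
  have hpi := pi_pos
  set t := Complex.arg (z : ℂ) with ht
  set m := ⌊t * n / (2 * π)⌋ with hm
  refine ⟨e.symm (m : ZMod n), ?_⟩
  have h1 : (m : ℝ) ≤ t * n / (2 * π) := Int.floor_le _
  have h2 : t * n / (2 * π) < m + 1 := Int.lt_floor_add_one _
  have hz : ZMod.toCircle (m : ZMod n) = Circle.exp (2 * π * m / n) := by
    ext
    rw [ZMod.toCircle_intCast, Circle.coe_exp]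
    push_cast
    congr 1
    ring
  rw [Equiv.apply_symm_apply, hz, ← Circle.exp_arg z]
  refine (geoDist_exp_le _ _).trans ?_
  rw [← ht, abs_le]
  rw [le_div_iff₀ (by positivity)] at h1
  rw [div_lt_iff₀ (by positivity)] at h2
  have h3 : t = t * n / n := by field_simp
  rw [h3, ← sub_div, ← neg_div]
  constructor
  · exact div_le_div_of_nonneg_right (by linarith) hn.le
  · exact div_le_div_of_nonneg_right (by linarith) hn.le

/-! ### Tuples with nearly the same pairwise distances -/

theorem coe_orthAct_conj (x : Circle) :
    (orthAct Complex.conjLIE x : ℂ) = starRingEnd ℂ (x : ℂ) := rfl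

theorem abs_cos_geoDist_sub_le {x y x' y' : Circle} {η : ℝ}
    (h : |geoDist x y - geoDist x' y'| ≤ η) :
    |((x : ℂ).re * (y : ℂ).re + (x : ℂ).im * (y : ℂ).im) -
      ((x' : ℂ).re * (y' : ℂ).re + (x' : ℂ).im * (y' : ℂ).im)| ≤ η := by
  rw [← cos_geoDist, ← cos_geoDist]
  exact (abs_cos_sub_cos_le _ _).trans h

/-- Inner products with `x i₀ = 1` are real parts; those with `x j₀`, close to `I`, are nearly
imaginary parts. The sign condition `him` excludes the mirror image. -/
theorem norm_sub_le_of_near_isometry {ι : Type*} {x x' : ι → Circle} {i₀ j₀ : ι} {η κ : ℝ}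
    (hx : x i₀ = 1) (hx' : x' i₀ = 1)
    (h : ∀ i j, |geoDist (x i) (x j) - geoDist (x' i) (x' j)| ≤ η)
    (hj : ‖(x j₀ : ℂ) - Complex.I‖ ≤ κ) (him : 0 ≤ (x' j₀ : ℂ).im) (i : ι) :
    ‖(x i : ℂ) - x' i‖ ≤ 4 * η + 3 * κ := by
  have hre : ∀ k, |(x k : ℂ).re - (x' k : ℂ).re| ≤ η := fun k => by
    simpa [hx, hx'] using abs_cos_geoDist_sub_le (h i₀ k)
  have h1 : |(x j₀ : ℂ).re| ≤ κ := by
    simpa using (Complex.abs_re_le_norm _).trans hj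
  have h2 : |(x j₀ : ℂ).im - 1| ≤ κ := by
    simpa using (Complex.abs_im_le_norm _).trans hj
  have hij := abs_cos_geoDist_sub_le (h i j₀)
  have hη : 0 ≤ η := (abs_nonneg _).trans (h i i)
  have h3 : |(x' j₀ : ℂ).re| ≤ κ + η := by
    have := hre j₀
    rw [abs_le] at *
    constructor <;> linarith
  have hu := re_sq_add_im_sq (x' j₀)
  have hi := re_sq_add_im_sq (x i)
  have hi' := re_sq_add_im_sq (x' i)
  have him1 : (x' j₀ : ℂ).im ≤ 1 := by nlinarith [sq_nonneg (x' j₀ : ℂ).re]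
  -- Since `0 ≤ im ≤ 1`, `1 - im ≤ 1 - im² = re² ≤ |re|`.
  have h4 : 1 - (x' j₀ : ℂ).im ≤ κ + η := by
    have ha : |(x' j₀ : ℂ).re| ≤ 1 := by
      rw [← sq_le_one_iff_abs_le_one]; nlinarith [sq_nonneg (x' j₀ : ℂ).im]
    have hb : |(x' j₀ : ℂ).re| ^ 2 ≤ |(x' j₀ : ℂ).re| := by
      nlinarith [abs_nonneg (x' j₀ : ℂ).re]
    rw [sq_abs] at hb
    nlinarith
  have h5 : ‖(x' j₀ : ℂ) - Complex.I‖ ≤ 2 * (κ + η) := by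
    refine (Complex.norm_le_abs_re_add_abs_im _).trans ?_
    have : |(x' j₀ : ℂ).im - 1| ≤ κ + η := by
      rw [abs_sub_comm, abs_of_nonneg (by linarith)]; exact h4
    simp only [Complex.sub_re, Complex.sub_im, Complex.I_re, Complex.I_im, sub_zero]
    linarith
  have inner_le : ∀ u v : ℂ, u.re ^ 2 + u.im ^ 2 = 1 → |u.re * v.re + u.im * v.im| ≤ ‖v‖ := by
    intro u v hu
    refine abs_le_of_sq_le_sq ?_ (norm_nonneg _)
    rw [← Complex.normSq_eq_norm_sq, Complex.normSq_apply]
    have key : v.re * v.re + v.im * v.im = (u.re ^ 2 + u.im ^ 2) * (v.re * v.re + v.im * v.im) := by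
      rw [hu, one_mul]
    nlinarith [sq_nonneg (u.re * v.im - u.im * v.re)]
  have h6 := (inner_le (x i) _ hi).trans hj
  have h7 := (inner_le (x' i) _ hi').trans h5
  simp only [Complex.sub_re, Complex.sub_im, Complex.I_re, Complex.I_im, sub_zero] at h6 h7
  -- The error is `η` from `hij`, `κ` from `h6` and `2(κ + η)` from `h7`.
  have h8 : |(x i : ℂ).im - (x' i : ℂ).im| ≤ 3 * η + 3 * κ := by
    rw [abs_le] at *
    constructor <;> linarith
  refine (Complex.norm_le_abs_re_add_abs_im _).trans ?_
  have := hre i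
  rw [Complex.sub_re, Complex.sub_im]
  linarith

theorem orthAct_trans (P Q : ℂ ≃ₗᵢ[ℝ] ℂ) (x : Circle) :
    orthAct (P.trans Q) x = orthAct Q (orthAct P x) := rfl

theorem exists_orthAct_near {ι : Type*} {x x' : ι → Circle} {i₀ j₀ : ι} {η κ : ℝ}
    (h : ∀ i j, |geoDist (x i) (x j) - geoDist (x' i) (x' j)| ≤ η)
    (hj : geoDist (x i₀ * Circle.exp (π / 2)) (x j₀) ≤ κ) :
    ∃ Q : ℂ ≃ₗᵢ[ℝ] ℂ, ∀ i, geoDist (x i) (orthAct Q (x' i)) ≤ π / 2 * (4 * η + 3 * κ) := by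
  obtain ⟨P, hP0, hPj⟩ : ∃ P : ℂ ≃ₗᵢ[ℝ] ℂ, orthAct P (x' i₀) = 1 ∧
      0 ≤ (orthAct P (x' j₀) : ℂ).im := by
    rcases le_total 0 (orthAct (rotation (x' i₀)⁻¹) (x' j₀) : ℂ).im with hs | hs
    · exact ⟨_, by rw [orthAct_rotation, inv_mul_cancel], hs⟩
    · refine ⟨(rotation (x' i₀)⁻¹).trans Complex.conjLIE, ?_, ?_⟩
      · rw [orthAct_trans, orthAct_rotation, inv_mul_cancel]
        ext
        simp [coe_orthAct_conj]
      · rw [orthAct_trans, coe_orthAct_conj, Complex.conj_im]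
        linarith
  have hI : (Circle.exp (π / 2) : ℂ) = Complex.I := by
    rw [Circle.coe_exp]; push_cast; exact Complex.exp_pi_div_two_mul_I
  have key := norm_sub_le_of_near_isometry (x := fun i => (x i₀)⁻¹ * x i)
    (x' := fun i => orthAct P (x' i)) (i₀ := i₀) (j₀ := j₀) (η := η) (κ := κ)
    (inv_mul_cancel _) hP0 (fun i j => by rw [geoDist_mul_left, geoDist_orthAct]; exact h i j)
    (by
      rw [← hI]
      refine (norm_sub_le_geoDist _ _).trans ?_
      rw [← geoDist_mul_left (x i₀), mul_inv_cancel_left, geoDist_comm]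
      exact hj) hPj
  refine ⟨P.trans (rotation (x i₀)), fun i => ?_⟩
  rw [orthAct_trans, orthAct_rotation, ← geoDist_mul_left (x i₀)⁻¹, inv_mul_cancel_left]
  exact (geoDist_le_norm_sub _ _).trans (by gcongr; exact key i)

/-- After rotating one point of each tuple to `1`, real parts agree, and so do all products of two
imaginary parts. The imaginary parts then agree up to one global sign. Unlike the approximate
version, no point near a quarter turn is needed. -/
theorem exists_orthAct_eq {ι : Type*} [Nonempty ι] {x x' : ι → Circle}
    (h : ∀ i j, geoDist (x i) (x j) = geoDist (x' i) (x' j)) :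
    ∃ Q : ℂ ≃ₗᵢ[ℝ] ℂ, ∀ i, x i = orthAct Q (x' i) := by
  obtain ⟨i₀⟩ := ‹Nonempty ι›
  set u : ι → Circle := fun i => (x i₀)⁻¹ * x i with hu
  set v : ι → Circle := fun i => (x' i₀)⁻¹ * x' i with hv
  have hg : ∀ i j, (u i : ℂ).re * (u j : ℂ).re + (u i : ℂ).im * (u j : ℂ).im =
      (v i : ℂ).re * (v j : ℂ).re + (v i : ℂ).im * (v j : ℂ).im := fun i j => by
    rw [← cos_geoDist, ← cos_geoDist, hu, hv, geoDist_mul_left, geoDist_mul_left, h]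
  have hre : ∀ i, (u i : ℂ).re = (v i : ℂ).re := fun i => by
    simpa [hu, hv] using hg i₀ i
  have him : ∀ i j, (u i : ℂ).im * (u j : ℂ).im = (v i : ℂ).im * (v j : ℂ).im := fun i j => by
    have := hg i j
    rw [hre i, hre j] at this
    linarith
  have hsuff : ∀ P : ℂ ≃ₗᵢ[ℝ] ℂ, (∀ i, u i = orthAct P (v i)) →
      ∃ Q : ℂ ≃ₗᵢ[ℝ] ℂ, ∀ i, x i = orthAct Q (x' i) := fun P hP =>
    ⟨((rotation (x' i₀)⁻¹).trans P).trans (rotation (x i₀)), fun i => by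
      rw [orthAct_trans, orthAct_trans, orthAct_rotation, orthAct_rotation, ← hP i,
        mul_inv_cancel_left]⟩
  by_cases hall : ∀ i, (u i : ℂ).im = (v i : ℂ).im
  · exact hsuff (LinearIsometryEquiv.refl ℝ ℂ) fun i => by
      ext
      exact Complex.ext (hre i) (hall i)
  · push Not at hall
    obtain ⟨j, hj⟩ := hall
    have hjneg : (u j : ℂ).im = -(v j : ℂ).im := by
      rcases mul_self_eq_mul_self_iff.1 (him j j) with h1 | h1
      · exact absurd h1 hj
      · exact h1
    have hj0 : (v j : ℂ).im ≠ 0 := fun h0 => hj (by rw [hjneg, h0, neg_zero])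
    refine hsuff Complex.conjLIE fun i => ?_
    ext
    rw [coe_orthAct_conj]
    refine Complex.ext (by rw [Complex.conj_re, hre i]) ?_
    rw [Complex.conj_im]
    have h1 := him i j
    rw [hjneg] at h1
    apply mul_right_cancel₀ hj0
    linarith

/-! ### Representations of the same matrix -/

theorem slack_nonneg {ce : ℝ} (hce : 0 ≤ ce) (n : ℕ) : 0 ≤ slack ce n :=
  mul_nonneg hce (sqrt_nonneg _)

theorem representations_apply {n : ℕ} {F : Matrix (Fin n) (Fin n) ℝ} (hF : F.IsSymm)
    {cl cL ce : ℝ} {x : Fin n → Circle} {f : Circle → Circle → ℝ}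
    (h : (x, f) ∈ representations F cl cL ce) {i j : Fin n} (hij : i ≠ j) :
    f (x i) (x j) = F i j := by
  rcases lt_or_gt_of_ne hij with h1 | h1
  · exact h.2 i j h1
  · exact (h.1.symm _ _).trans ((h.2 j i h1).trans (hF.apply i j))

/-- Up to the slack, two representations order the distances to a given point alike. -/
theorem geoDist_le_of_representations {n : ℕ} {F : Matrix (Fin n) (Fin n) ℝ} (hF : F.IsSymm)
    {cl cL ce : ℝ} (hcl : 0 < cl) (hce : 0 ≤ ce) {x x' : Fin n → Circle}
    {f f' : Circle → Circle → ℝ} (h : (x, f) ∈ representations F cl cL ce)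
    (h' : (x', f') ∈ representations F cl cL ce) {i j k : Fin n} (hij : i ≠ j)
    (hk : geoDist (x i) (x k) ≤ geoDist (x i) (x j) - 2 * slack ce n / cl) :
    geoDist (x' i) (x' k) ≤ geoDist (x' i) (x' j) := by
  -- `F` says nothing about diagonal values of `f`.
  rcases eq_or_ne i k with rfl | hik
  · rw [geoDist_self]; exact geoDist_nonneg _ _
  by_contra! hlt
  have hs : 0 ≤ 2 * slack ce n / cl :=
    div_nonneg (mul_nonneg zero_le_two (slack_nonneg hce n)) hcl.le
  have h1 := h.1.lower (x i) (x j) (x k) (by linarith)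
  have h2 := h'.1.lower (x' i) (x' k) (x' j) hlt.le
  simp only [representations_apply hF h hij, representations_apply hF h hik] at h1
  simp only [representations_apply hF h' hij, representations_apply hF h' hik] at h2
  -- In the sum of `h1` and `h2` the entries of `F` cancel, so `c_l` times the two gaps is at most
  -- `2ε`, while the first gap alone already uses up `2ε`.
  have h3 : cl * (2 * slack ce n / cl) ≤ cl * (geoDist (x i) (x j) - geoDist (x i) (x k)) := by
    gcongr; linarith
  rw [mul_div_cancel₀ _ hcl.ne'] at h3
  have h4 : 0 < cl * (geoDist (x' i) (x' k) - geoDist (x' i) (x' j)) :=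
    mul_pos hcl (by linarith)
  linarith

/-- The indices counted on the left are among those on the right. Replacing both endpoints by
regular positions costs `2D`, respectively `2D'`. -/
theorem rootCount_le_of_representations {n : ℕ} [NeZero n] {F : Matrix (Fin n) (Fin n) ℝ}
    (hF : F.IsSymm) {cl cL ce : ℝ} (hcl : 0 < cl) (hce : 0 ≤ ce) {x x' : Fin n → Circle}
    {f f' : Circle → Circle → ℝ} (h : (x, f) ∈ representations F cl cL ce)
    (h' : (x', f') ∈ representations F cl cL ce) {e e' : Fin n ≃ ZMod n} {D D' : ℝ}
    (he : ∀ k, geoDist (x k) (ZMod.toCircle (e k)) ≤ D)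
    (he' : ∀ k, geoDist (x' k) (ZMod.toCircle (e' k)) ≤ D') {i j : Fin n} (hij : i ≠ j) :
    rootCount n (geoDist (x i) (x j) - 2 * slack ce n / cl - 2 * D) ≤
      rootCount n (geoDist (x' i) (x' j) + 2 * D') := by
  rw [← ncard_index_eq_rootCount e i, ← ncard_index_eq_rootCount e' i]
  refine Set.ncard_le_ncard (fun k hk => ?_) (Set.toFinite _)
  simp only [Set.mem_ofPred_eq] at hk ⊢
  have hxk : geoDist (x i) (x k) ≤ geoDist (x i) (x j) - 2 * slack ce n / cl := by
    have h1 := geoDist_triangle (x i) (ZMod.toCircle (e i)) (x k)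
    have h2 := geoDist_triangle (ZMod.toCircle (e i)) (ZMod.toCircle (e k)) (x k)
    have h3 := he k
    rw [geoDist_comm] at h3
    linarith [he i]
  have hxk' := geoDist_le_of_representations hF hcl hce h h' hij hxk
  have h1 := geoDist_triangle (ZMod.toCircle (e' i)) (x' i) (ZMod.toCircle (e' k))
  have h2 := geoDist_triangle (x' i) (x' k) (ZMod.toCircle (e' k))
  have h3 := he' i
  rw [geoDist_comm] at h3
  linarith [he' k]

theorem geoDist_le_add_of_representations {n : ℕ} [NeZero n] {F : Matrix (Fin n) (Fin n) ℝ}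
    (hF : F.IsSymm) {cl cL ce : ℝ} (hcl : 0 < cl) (hce : 0 ≤ ce) {x x' : Fin n → Circle}
    {f f' : Circle → Circle → ℝ} (h : (x, f) ∈ representations F cl cL ce)
    (h' : (x', f') ∈ representations F cl cL ce) {e e' : Fin n ≃ ZMod n} {D D' : ℝ}
    (he : ∀ k, geoDist (x k) (ZMod.toCircle (e k)) ≤ D)
    (he' : ∀ k, geoDist (x' k) (ZMod.toCircle (e' k)) ≤ D') (i j : Fin n) :
    geoDist (x i) (x j) ≤
      geoDist (x' i) (x' j) + (2 * slack ce n / cl + 2 * D + 2 * D' + 2 * π / n) := by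
  have hD : 0 ≤ D := (geoDist_nonneg _ _).trans (he i)
  have hD' : 0 ≤ D' := (geoDist_nonneg _ _).trans (he' i)
  have hs : 0 ≤ 2 * slack ce n / cl :=
    div_nonneg (mul_nonneg zero_le_two (slack_nonneg hce n)) hcl.le
  have hpi : 0 ≤ 2 * π / n := by positivity
  rcases eq_or_ne i j with rfl | hij
  · rw [geoDist_self, geoDist_self]; linarith
  have h1 := le_of_rootCount_le
    (by linarith [geoDist_nonneg (x' i) (x' j)]) (by linarith [geoDist_le_pi (x i) (x j)])
    (rootCount_le_of_representations hF hcl hce h h' he he' hij)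
  linarith

/-- Here `d(x i, x j)` is itself a distance between roots, so `rootCount` jumps exactly there and
the `2π/n` loss disappears. -/
theorem geoDist_le_of_regular {n : ℕ} [NeZero n] {F : Matrix (Fin n) (Fin n) ℝ}
    (hF : F.IsSymm) {cl cL : ℝ} (hcl : 0 < cl) {x x' : Fin n → Circle}
    {f f' : Circle → Circle → ℝ} (h : (x, f) ∈ representations F cl cL 0)
    (h' : (x', f') ∈ representations F cl cL 0) (hx : x ∈ regularPositions n)
    (hx' : x' ∈ regularPositions n) (i j : Fin n) :
    geoDist (x i) (x j) ≤ geoDist (x' i) (x' j) := by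
  obtain ⟨e, he⟩ := exists_equiv_zmod hx
  obtain ⟨e', he'⟩ := exists_equiv_zmod hx'
  rcases eq_or_ne i j with rfl | hij
  · rw [geoDist_self, geoDist_self]
  by_contra! hlt
  have h1 := rootCount_le_of_representations hF hcl le_rfl h h' (D := 0) (D' := 0)
    (fun k => by rw [he k, geoDist_self]) (fun k => by rw [he' k, geoDist_self]) hij
  simp only [slack, zero_mul, mul_zero, zero_div, sub_zero, add_zero] at h1
  have hij' : geoDist 1 (ZMod.toCircle (e j - e i)) = geoDist (x i) (x j) := by
    rw [he i, he j, geoDist_toCircle]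
  exact absurd h1 (not_le.2 (rootCount_lt hlt (e j - e i) (by rwa [hij']) hij'.le))

theorem inv_le_sqrt_log_div {n : ℕ} (hn : 2 ≤ n) : 1 / (n : ℝ) ≤ √(log n / n) := by
  have hn' : (2 : ℝ) ≤ n := by exact_mod_cast hn
  have hlog : 1 / 2 ≤ log n := by
    have := log_le_log two_pos hn'
    linarith [log_two_gt_d9]
  refine le_sqrt_of_sq_le ?_
  rw [div_pow, one_pow, div_le_div_iff₀ (by positivity) (by positivity)]
  nlinarith

theorem orbitDist_le_of_representations {n : ℕ} [NeZero n] {F : Matrix (Fin n) (Fin n) ℝ}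
    (hF : F.IsSymm) {cl cL ce : ℝ} (hcl : 0 < cl) (hce : 0 ≤ ce) {x x' : Fin n → Circle}
    {f f' : Circle → Circle → ℝ} (h : (x, f) ∈ representations F cl cL ce)
    (h' : (x', f') ∈ representations F cl cL ce) :
    orbitDist x x' ≤ π / 2 * (4 * (2 * slack ce n / cl + 2 * distToRegular x +
      2 * distToRegular x' + 2 * π / n) + 3 * (2 * π / n + distToRegular x)) := by
  obtain ⟨y, hy, hxy⟩ := exists_maxDist_eq_distToRegular x
  obtain ⟨y', hy', hxy'⟩ := exists_maxDist_eq_distToRegular x'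
  obtain ⟨e, he⟩ := exists_equiv_zmod hy
  obtain ⟨e', he'⟩ := exists_equiv_zmod hy'
  have hD : ∀ k, geoDist (x k) (ZMod.toCircle (e k)) ≤ distToRegular x := fun k => by
    rw [← he, ← hxy]; exact geoDist_le_maxDist x y k
  have hD' : ∀ k, geoDist (x' k) (ZMod.toCircle (e' k)) ≤ distToRegular x' := fun k => by
    rw [← he', ← hxy']; exact geoDist_le_maxDist x' y' k
  obtain ⟨j₀, hj₀⟩ := exists_geoDist_le e (x 0 * Circle.exp (π / 2))
  obtain ⟨Q, hQ⟩ := exists_orthAct_near (x := x) (x' := x') (i₀ := 0) (j₀ := j₀)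
    (η := 2 * slack ce n / cl + 2 * distToRegular x + 2 * distToRegular x' + 2 * π / n)
    (κ := 2 * π / n + distToRegular x)
    (fun i j => abs_sub_le_iff.2
      ⟨by linarith [geoDist_le_add_of_representations hF hcl hce h h' hD hD' i j],
        by linarith [geoDist_le_add_of_representations hF hcl hce h' h hD' hD i j]⟩)
    (by
      refine (geoDist_triangle _ (ZMod.toCircle (e j₀)) _).trans (add_le_add hj₀ ?_)
      rw [geoDist_comm]
      exact hD j₀)
  exact (orbitDist_le x x' Q).trans (ciSup_le hQ)

end CircleSeriation
end

theorem proposition2p2 (cl cL ce : ℝ) (hcl : 0 < cl) (hcL : cl ≤ cL) (hce : 0 ≤ ce) :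
    ∃ C : ℝ, 0 < C ∧
      ∀ (n : ℕ), 0 < n →
      ∀ (F : Matrix (Fin n) (Fin n) ℝ), F.IsSymm →
      ∀ (xs : Fin n → Circle) (fs : Circle → Circle → ℝ),
        CircleSeriation.IsBiLipschitz n cl cL ce fs →
        (∀ i j, i < j → F i j = fs (xs i) (xs j)) →
      ∀ (x x' : Fin n → Circle) (f f' : Circle → Circle → ℝ),
        (x, f) ∈ CircleSeriation.representations F cl cL ce →
        (x', f') ∈ CircleSeriation.representations F cl cL ce →
        CircleSeriation.orbitDist x x' ≤
            C * (CircleSeriation.distToRegular x + CircleSeriation.distToRegular x' +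
              Real.sqrt (Real.log (n : ℝ) / (n : ℝ))) ∧
          (ce = 0 → x ∈ CircleSeriation.regularPositions n →
            x' ∈ CircleSeriation.regularPositions n →
            ∃ Q : ℂ ≃ₗᵢ[ℝ] ℂ, x = CircleSeriation.orthTuple Q x') := by
  have hpi := Real.pi_pos
  -- Expanding `4η + 3κ` gives `8ε/c_l + 11D + 8D' + 14π/n`; the factor `π/2` converts chords to
  -- arcs.
  refine ⟨Real.pi / 2 * (8 * ce / cl + 11 + 14 * Real.pi), by positivity,
    fun n hn F hF _ _ _ _ x x' f f' h h' => ?_⟩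
  have : NeZero n := ⟨hn.ne'⟩
  have hD := CircleSeriation.distToRegular_nonneg x
  have hD' := CircleSeriation.distToRegular_nonneg x'
  refine ⟨?_, ?_⟩
  -- For `n = 1`, `log n = 0` cannot absorb `2π/n`, but the orbit distance is zero.
  · rcases (show n = 1 ∨ 2 ≤ n by omega) with rfl | hn2
    · obtain ⟨Q, hQ⟩ := CircleSeriation.exists_orthAct_eq (x := x) (x' := x') fun i j => by
        rw [Subsingleton.elim i j, CircleSeriation.geoDist_self, CircleSeriation.geoDist_self]
      have hQ' : x = CircleSeriation.orthTuple Q x' := funext hQ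
      refine (CircleSeriation.orbitDist_le x x' Q).trans ?_
      rw [← hQ', CircleSeriation.maxDist_self]
      positivity
    · refine (CircleSeriation.orbitDist_le_of_representations hF hcl hce h h').trans ?_
      have hS := CircleSeriation.inv_le_sqrt_log_div hn2
      rw [CircleSeriation.slack, mul_assoc]
      set S := Real.sqrt (Real.log (n : ℝ) / (n : ℝ))
      have hS0 : 0 ≤ S := Real.sqrt_nonneg _
      set D := CircleSeriation.distToRegular x
      set D' := CircleSeriation.distToRegular x'
      refine mul_le_mul_of_nonneg_left ?_ (by positivity)
      have h1 : 2 * Real.pi / n ≤ 2 * Real.pi * S := by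
        rw [div_eq_mul_one_div]; gcongr
      have h2 : 0 ≤ (8 * ce / cl + 14 * Real.pi) * (D + D') := by positivity
      have h3 : 2 * (ce * S) / cl = 2 * (ce / cl * S) := by ring
      have h4 : 8 * ce / cl = 8 * (ce / cl) := by ring
      rw [h3]
      rw [h4] at h2 ⊢
      linarith
  · rintro rfl hx hx'
    obtain ⟨Q, hQ⟩ := CircleSeriation.exists_orthAct_eq (x := x) (x' := x') fun i j =>
      le_antisymm (CircleSeriation.geoDist_le_of_regular hF hcl h h' hx hx' i j)
        (CircleSeriation.geoDist_le_of_regular hF hcl h' h hx' hx i j)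
    exact ⟨Q, funext hQ⟩
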